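/- **Theorem (Linear fan-beam backprojection Theorem).** Let $D>0$, put $\xi_\theta=(\cos\theta,\sin\theta)$ and let $r_\beta=D(-\sin\beta,\cos\beta)$ be the position of the source at angle $\beta$. Let $g=g(s,\beta)$ be a linear fan-beam sinogram: a real-valued continuous function on $\mathbb R\times\mathbb R/2\pi\mathbb Z$ that decreases rapidly in $s$, i.e. $\sup_{s,\beta}|s|^k|g(s,\beta)|<\infty$ for every $k\ge 0$. Its linear fan-beam backprojection is the function on $\mathbb R^2$ $$\mathcal B_\ell g(x)=\int_0^{2\pi}\frac{1}{D\,|U_\beta|}\sqrt{s_\beta^2+D^2}\;g(s_\beta,\beta)\,d\beta,\qquad U_\beta=\frac{D^2-r_\beta\cdot x}{D^2},\quad s_\beta=\frac{x\cdot\xi_\beta}{U_\beta}$$ (the integrand is taken to be $0$ at the at most two angles $\beta$ with $U_\beta=0$; for $|x|<D$ one has $U_\beta>0$). It is computed in two steps. (i) Let $w=\mathcal L g$, where $\mathcal L g(\gamma,\beta)=g(D\tan\gamma,\beta)$ if $\gamma\ne\pi/2 \bmod \pi$ and $\mathcal L g(\gamma,\beta)=0$ otherwise; let $z(\gamma,\beta)=\tau(\gamma)\,w(\gamma,\beta)$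 with $\tau(\gamma)=D\sec^2\gamma$ (and $z=0$ where $\gamma=\pi/2\bmod\pi$); and let $Z(\gamma,\theta)=z(\gamma,\theta-\gamma)$. (ii) Put $c_n(\theta)=\frac1{2\pi}\int_0^{2\pi}Z(\gamma,\theta)e^{-in\gamma}\,d\gamma$, $b_0=2\pi c_0$ and $b_n=2\pi\,[c_n+(-1)^n\overline{c_n}]$ for $n\ge1$, and let $J_n$ be the Bessel functions of the first kind. Then $$\widehat{\mathcal B_\ell g}(\sigma\xi_\theta)=\frac1\sigma\sum_{n=0}^\infty b_n(\theta)\,J_n(D\sigma)\qquad(\sigma>0,\ \theta\in\mathbb R/2\pi\mathbb Z).$$ Here the integral defining $\mathcal B_\ell g(x)$ converges for every $x$, $Z$ is continuous, and the series converges for all $\sigma>0$ and $\theta$. The Fourier transform on $\mathbb R^2$ is $\hat\varphi(\omega)=\frac1{2\pi}\int_{\mathbb R^2}\varphi(x)e^{-ix\cdot\omega}\,dx$, and $\widehat{\mathcal B_\ell g}$ is taken in the sense of tempered distributions: it is a function, continuous on $\mathbb R^2\setminus\{0\}$, such that $\mathcal B_\ell g$ and $\widehat{\mathcal B_\ell g}$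 are both integrable against every Schwartz function and $\int\mathcal B_\ell g\,\hat\varphi=\int\widehat{\mathcal B_\ell g}\,\varphi$ for every Schwartz function $\varphi$. -/

import Mathlib

open scoped SchwartzMap

noncomputable section

namespace FanBeam

/-- The plane with its Euclidean norm. -/
abbrev Plane : Type := EuclideanSpace ℝ (Fin 2)

/-- The unit vector `ξ_θ = (cos θ, sin θ)`. -/
def xi (θ : ℝ) : Plane := !₂[Real.cos θ, Real.sin θ]

/-- The source `r_β = D (-sin β, cos β)`: the common point of all the lines
`x · ξ_{β + γ} = D sin γ` of the fan with source angle `β`. -/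
def source (D β : ℝ) : Plane := !₂[-(D * Real.sin β), D * Real.cos β]

/-- Linear fan-beam sinograms: continuous functions `g (s, β)` on `ℝ × ℝ/2πℤ` (written as functions
of two real variables, `2π`-periodic in the second) that decrease rapidly in `s`,
uniformly in `β`. All functions of Schwartz class on `ℝ × ℝ/2πℤ` are of this kind. -/
structure IsLinearSinogram (g : ℝ → ℝ → ℝ) : Prop where
  continuous : Continuous (Function.uncurry g)
  periodic : ∀ s β, g s (β + 2 * Real.pi) = g s β
  rapid_decay : ∀ k : ℕ, ∃ C : ℝ, ∀ s β, |s| ^ k * |g s β| ≤ C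

/-- The ratio `U_β = (D² - r_β · x) / D²`. -/
def ratioU (D : ℝ) (x : Plane) (β : ℝ) : ℝ := (D ^ 2 - inner ℝ (source D β) x) / D ^ 2

/-- The height `s_β = (x · ξ_β) / U_β` at which the line from the source through `x` meets the
detector (for `U_β = 0` this line is parallel to the detector or undefined). -/
def heightS (D : ℝ) (x : Plane) (β : ℝ) : ℝ := inner ℝ x (xi β) / ratioU D x β

/-- The integrand of the linear fan-beam backprojection. Where `U_β = 0`, which happens for at most
two source angles modulo `2π`, it takes the value `0`. -/
def backprojectionIntegrand (D : ℝ) (g : ℝ → ℝ → ℝ) (x : Plane) (β : ℝ) : ℝ :=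
  1 / (D * |ratioU D x β|) * Real.sqrt (heightS D x β ^ 2 + D ^ 2) * g (heightS D x β) β

/-- The linear fan-beam backprojection `B_ℓ g`. -/
def linearBackprojection (D : ℝ) (g : ℝ → ℝ → ℝ) (x : Plane) : ℝ :=
  ∫ β in (0 : ℝ)..(2 * Real.pi), backprojectionIntegrand D g x β

/-- The rebinning `w = L g`: `w (γ, β) = g (D tan γ, β)` if `γ ≠ π/2` modulo `π`, and `0`
otherwise. -/
def rebin (D : ℝ) (g : ℝ → ℝ → ℝ) (γ β : ℝ) : ℝ :=
  open scoped Classical in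
  if ∃ k : ℤ, γ = Real.pi / 2 + k * Real.pi then 0 else g (D * Real.tan γ) β

/-- The weight `τ (γ) = D sec² γ`. -/
def tau (D γ : ℝ) : ℝ := D * (1 / Real.cos γ) ^ 2

/-- The shear `(A z) (γ, θ) = z (γ, θ - γ)`. -/
def shear (z : ℝ → ℝ → ℝ) (γ θ : ℝ) : ℝ := z γ (θ - γ)

/-- The Fourier coefficients `c_n (θ) = (1/2π) ∫_0^{2π} Z (γ, θ) e^{-inγ} dγ`. -/
def coeffC (Z : ℝ → ℝ → ℝ) (n : ℕ) (θ : ℝ) : ℂ :=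
  1 / (2 * (Real.pi : ℂ)) *
    ∫ γ in (0 : ℝ)..(2 * Real.pi), (Z γ θ : ℂ) * Complex.exp (-(Complex.I * n * γ))

/-- The coefficients `b_0 = 2π c_0` and `b_n = 2π (c_n + (-1)^n conj c_n)` for `n ≥ 1`. -/
def coeffB (Z : ℝ → ℝ → ℝ) (n : ℕ) (θ : ℝ) : ℂ :=
  if n = 0 then 2 * (Real.pi : ℂ) * coeffC Z 0 θ
  else 2 * (Real.pi : ℂ) * (coeffC Z n θ + (-1) ^ n * (starRingEnd ℂ) (coeffC Z n θ))

/-- The Bessel function of the first kind of integer order `n ≥ 0`. -/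
def besselJ (n : ℕ) (x : ℝ) : ℝ :=
  ∑' k : ℕ, (-1) ^ k / ((k.factorial : ℝ) * ((n + k).factorial : ℝ)) * (x / 2) ^ (2 * k + n)

/-- The Fourier transform `(1/2π) ∫ φ(y) e^{-i x·y} dy` of a function on the plane. -/
def planeFourier (φ : Plane → ℂ) (x : Plane) : ℂ :=
  1 / (2 * (Real.pi : ℂ)) * ∫ y : Plane, Complex.exp (-(Complex.I * (inner ℝ x y : ℝ))) * φ y

/-- `v` is the Fourier transform of `u` in the sense of tempered distributions: `u` and `v` are
integrable against all Schwartz functions, and `∫ u φ̂ = ∫ v φ` for each Schwartz function `φ`. -/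
def IsDistributionalFourier (u v : Plane → ℂ) : Prop :=
  (∀ φ : 𝓢(Plane, ℂ), MeasureTheory.Integrable fun x => u x * φ x) ∧
  (∀ φ : 𝓢(Plane, ℂ), MeasureTheory.Integrable fun ω => v ω * φ ω) ∧
  ∀ φ : 𝓢(Plane, ℂ), ∫ x, u x * planeFourier (fun ω => φ ω) x = ∫ ω, v ω * φ ω

end FanBeam

end

/-!
The contribution of a source angle `β` to the backprojection is, as a function of `x`, a bounded
function of the direction of `x - r_β`, invariant under `x - r_β ↦ -(x - r_β)`, divided by
`|x - r_β|` (`backprojectionIntegrand_eq`). The bounded factor is `fanKernel`, homogeneous of degree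
`0` in the components of `x - r_β`; at polar angle `γ` it is the weighted rebinned datum
`z (γ, β)` (`tau_mul_rebin`). The rapid decay of `g` makes it vanish to second order where the line
is parallel to the detector. This gives the continuity of `Z`, and the convergence of the
backprojection integral even at points of the source circle.

For fixed `β` the Fourier transform of this contribution is explicit
(`integral_backprojectionIntegrand_mul_planeFourier`). In polar coordinates with signed radius about
`r_β`, the Jacobian cancels the denominator, and the pairing with `φ̂` becomes an integral of the
kernel against the integrals of `φ̂` over the lines through `r_β`. By the slice theorem these are
one-dimensional Fourier integrals of `φ` over the perpendicular lines through the origin, and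
polar coordinates about the origin reassemble them. So the transform is again a bounded function of
the direction, divided by `|ω|` and multiplied by the phase `exp (-i ω · r_β)`. Everything is
dominated by the integrable function `1 / (|x| (1 + |x|²))` and its translates, hence the result
can be integrated over `β`. On the ray `ω = σ ξ_θ` the substitution `γ = θ - β` yields
`(1/σ) ∫ Z (γ, θ) exp (-i D σ sin γ) dγ` (`backprojectionFourier_polar`).

Finally, the Jacobi–Anger expansion of `exp (-i D σ sin γ)` (`hasSum_jacobiAnger`), integrated term
by term, turns this integral into the series of the `b_n (θ) J_n (D σ)`.
-/

noncomputable section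

open MeasureTheory Filter Topology

namespace FanBeam

/-! ### Vectors in the plane -/

/-- The unit vector `(-sin θ, cos θ)`, orthogonal to `ξ_θ`. -/
def perp (θ : ℝ) : Plane := !₂[-Real.sin θ, Real.cos θ]

lemma inner_plane (x y : Plane) : inner ℝ x y = x 0 * y 0 + x 1 * y 1 := by
  simp [PiLp.inner_apply, Fin.sum_univ_two, mul_comm]

lemma norm_sq_plane (x : Plane) : ‖x‖ ^ 2 = x 0 ^ 2 + x 1 ^ 2 := by
  simp [EuclideanSpace.norm_sq_eq, Fin.sum_univ_two]

@[simp] lemma xi_zero (θ : ℝ) : xi θ 0 = Real.cos θ := rfl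
@[simp] lemma xi_one (θ : ℝ) : xi θ 1 = Real.sin θ := rfl
@[simp] lemma perp_zero (θ : ℝ) : perp θ 0 = -Real.sin θ := rfl
@[simp] lemma perp_one (θ : ℝ) : perp θ 1 = Real.cos θ := rfl

lemma source_eq (D β : ℝ) : source D β = D • perp β := by
  ext i; fin_cases i <;> simp [source, perp]

lemma xi_add_pi_div_two (θ : ℝ) : xi (θ + Real.pi / 2) = perp θ := by
  ext i; fin_cases i <;> simp [xi, perp, Real.cos_add_pi_div_two, Real.sin_add_pi_div_two]

@[simp] lemma norm_xi (θ : ℝ) : ‖xi θ‖ = 1 := by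
  have h := norm_sq_plane (xi θ)
  simp only [xi_zero, xi_one, Real.cos_sq_add_sin_sq] at h
  nlinarith [norm_nonneg (xi θ)]

@[simp] lemma norm_perp (θ : ℝ) : ‖perp θ‖ = 1 := by
  rw [← xi_add_pi_div_two, norm_xi]

lemma norm_source {D : ℝ} (hD : 0 < D) (β : ℝ) : ‖source D β‖ = D := by
  rw [source_eq, norm_smul, norm_perp, mul_one, Real.norm_of_nonneg hD.le]

@[fun_prop] lemma continuous_xi : Continuous xi := by
  unfold xi; fun_prop

@[fun_prop] lemma continuous_perp : Continuous perp := by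
  unfold perp; fun_prop

@[fun_prop] lemma continuous_source (D : ℝ) : Continuous (source D) := by
  unfold source; fun_prop

lemma inner_xi_sq_add_inner_perp_sq (x : Plane) (θ : ℝ) :
    inner ℝ x (xi θ) ^ 2 + inner ℝ x (perp θ) ^ 2 = ‖x‖ ^ 2 := by
  simp only [inner_plane, norm_sq_plane, xi_zero, xi_one, perp_zero, perp_one]
  linear_combination (x 0 ^ 2 + x 1 ^ 2) * Real.sin_sq_add_cos_sq θ

/-! ### The homogeneous kernel -/

/-- The weighted rebinning `sec² γ · D · g (D tan γ, β)` as a function of a vector `(a, b)` of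
polar angle `γ`, of any length. On `a = 0` division by zero makes it `0`, which is the value
prescribed there. -/
def fanKernel (D : ℝ) (g : ℝ → ℝ → ℝ) (a b β : ℝ) : ℝ :=
  D * (a ^ 2 + b ^ 2) / a ^ 2 * g (D * b / a) β

lemma fanKernel_smul (D : ℝ) (g : ℝ → ℝ → ℝ) {t : ℝ} (ht : t ≠ 0) (a b β : ℝ) :
    fanKernel D g (t * a) (t * b) β = fanKernel D g a b β := by
  unfold fanKernel
  rcases eq_or_ne a 0 with rfl | ha
  · simp
  · congr 1
    · field_simp
    · congr 1; field_simp

/-- Rapid decay of `g` gives quadratic vanishing of the kernel on the line `a = 0`. -/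
lemma exists_fanKernel_le {D : ℝ} (hD : 0 < D) {g : ℝ → ℝ → ℝ} (hg : IsLinearSinogram g) :
    ∃ C, 0 ≤ C ∧ ∀ a b β, |fanKernel D g a b β| ≤ C * (a ^ 2 / (a ^ 2 + b ^ 2)) := by
  obtain ⟨C₀, h₀⟩ := hg.rapid_decay 0
  obtain ⟨C₄, h₄⟩ := hg.rapid_decay 4
  have hC₀ : 0 ≤ C₀ := le_trans (by positivity) (h₀ 0 0)
  have hC₄ : 0 ≤ C₄ := le_trans (by positivity) (h₄ 0 0)
  -- In terms of `s = D b / a`, the ratio `a² / (a² + b²)` is `D² / (D² + s²)`; the weight of the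
  -- kernel contributes its inverse, so that decay like `(D² + s²)⁻²` leaves one factor.
  set K := 2 * (D ^ 4 * C₀ + C₄) with hK
  have hdec : ∀ s β, (D ^ 2 + s ^ 2) ^ 2 * |g s β| ≤ K := by
    intro s β
    have e₀ := h₀ s β
    have e₄ := h₄ s β
    have : |s| ^ 4 = s ^ 4 := by rw [← abs_pow, abs_of_nonneg (by positivity)]
    rw [this] at e₄
    have h1 : (D ^ 2 + s ^ 2) ^ 2 ≤ 2 * (D ^ 4 + s ^ 4) := by nlinarith [sq_nonneg (D ^ 2 - s ^ 2)]
    have h2 := mul_le_mul_of_nonneg_right h1 (abs_nonneg (g s β))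
    have h3 := mul_le_mul_of_nonneg_left e₀ (by positivity : 0 ≤ D ^ 4)
    simp only [pow_zero, one_mul] at h3
    linarith
  refine ⟨K / D ^ 3, by positivity, fun a b β => ?_⟩
  rcases eq_or_ne a 0 with rfl | ha
  · simp [fanKernel]
  have hab : 0 < a ^ 2 + b ^ 2 := by positivity
  have h := hdec (D * b / a) β
  unfold fanKernel
  rw [abs_mul, abs_of_nonneg (by positivity : 0 ≤ D * (a ^ 2 + b ^ 2) / a ^ 2)]
  have e : D * (a ^ 2 + b ^ 2) / a ^ 2
      = (D ^ 2 + (D * b / a) ^ 2) ^ 2 * (a ^ 2 / (a ^ 2 + b ^ 2) / D ^ 3) := by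
    field_simp
  calc _ = ((D ^ 2 + (D * b / a) ^ 2) ^ 2 * |g (D * b / a) β|)
            * (a ^ 2 / (a ^ 2 + b ^ 2) / D ^ 3) := by rw [e]; ring
    _ ≤ K * (a ^ 2 / (a ^ 2 + b ^ 2) / D ^ 3) := by gcongr
    _ = _ := by ring

lemma exists_fanKernel_bounded {D : ℝ} (hD : 0 < D) {g : ℝ → ℝ → ℝ} (hg : IsLinearSinogram g) :
    ∃ C, 0 ≤ C ∧ ∀ a b β, |fanKernel D g a b β| ≤ C := by
  obtain ⟨C, hC, h⟩ := exists_fanKernel_le hD hg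
  refine ⟨C, hC, fun a b β => (h a b β).trans (mul_le_of_le_one_right hC ?_)⟩
  exact div_le_one_of_le₀ (by nlinarith [sq_nonneg b]) (by positivity)

lemma continuousAt_fanKernel {D : ℝ} (hD : 0 < D) {g : ℝ → ℝ → ℝ} (hg : IsLinearSinogram g)
    {p : ℝ × ℝ × ℝ} (hp : p.1 ^ 2 + p.2.1 ^ 2 ≠ 0) :
    ContinuousAt (fun q : ℝ × ℝ × ℝ => fanKernel D g q.1 q.2.1 q.2.2) p := by
  by_cases ha : p.1 = 0
  -- At `a = 0` the value is `0`, and the quadratic bound tends to `0` there.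
  · obtain ⟨C, hC, h⟩ := exists_fanKernel_le hD hg
    have h0 : fanKernel D g p.1 p.2.1 p.2.2 = 0 := by simp [fanKernel, ha]
    rw [ContinuousAt, h0]
    refine squeeze_zero_norm (fun q => h q.1 q.2.1 q.2.2) ?_
    have : ContinuousAt (fun q : ℝ × ℝ × ℝ => C * (q.1 ^ 2 / (q.1 ^ 2 + q.2.1 ^ 2))) p := by
      fun_prop (disch := assumption)
    simpa [ContinuousAt, ha] using this
  · have hc : ContinuousAt (fun q : ℝ × ℝ × ℝ => (D * q.2.1 / q.1, q.2.2)) p := by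
      fun_prop (disch := assumption)
    have hgc : ContinuousAt (fun q : ℝ × ℝ × ℝ => g (D * q.2.1 / q.1) q.2.2) p :=
      ContinuousAt.comp (g := Function.uncurry g) hg.continuous.continuousAt hc
    have : p.1 ^ 2 ≠ 0 := pow_ne_zero 2 ha
    exact ContinuousAt.mul (by fun_prop (disch := assumption)) hgc

lemma _root_.Continuous.fanKernel {X : Type*} [TopologicalSpace X] {D : ℝ} (hD : 0 < D)
    {g : ℝ → ℝ → ℝ} (hg : IsLinearSinogram g) {a b β : X → ℝ} (ha : Continuous a)
    (hb : Continuous b) (hβ : Continuous β) (h : ∀ x, a x ^ 2 + b x ^ 2 ≠ 0) :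
    Continuous fun x => fanKernel D g (a x) (b x) (β x) :=
  continuous_iff_continuousAt.2 fun x =>
    ContinuousAt.comp (f := fun x => (a x, b x, β x))
      (g := fun q : ℝ × ℝ × ℝ => FanBeam.fanKernel D g q.1 q.2.1 q.2.2)
      (continuousAt_fanKernel hD hg (h x)) (by fun_prop)

lemma measurable_fanKernel {X : Type*} [MeasurableSpace X] (D : ℝ) {g : ℝ → ℝ → ℝ}
    (hg : IsLinearSinogram g) {a b β : X → ℝ} (ha : Measurable a) (hb : Measurable b)
    (hβ : Measurable β) : Measurable fun x => fanKernel D g (a x) (b x) (β x) := by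
  have h : Measurable fun x => (D * b x / a x, β x) := by fun_prop
  have := hg.continuous.measurable.comp h
  exact Measurable.mul (by fun_prop) this

lemma tau_mul_rebin (D : ℝ) (g : ℝ → ℝ → ℝ) (γ β : ℝ) :
    tau D γ * rebin D g γ β = fanKernel D g (Real.cos γ) (Real.sin γ) β := by
  have hk : (∃ k : ℤ, γ = Real.pi / 2 + k * Real.pi) ↔ Real.cos γ = 0 := by
    rw [Real.cos_eq_zero_iff]
    refine exists_congr fun k => ?_
    constructor <;> intro h <;> rw [h] <;> ring
  unfold rebin fanKernel tau
  by_cases hc : Real.cos γ = 0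
  · rw [if_pos (hk.2 hc)]; simp [hc]
  · rw [if_neg (mt hk.1 hc), Real.cos_sq_add_sin_sq, Real.tan_eq_sin_div_cos]
    congr 1
    · field_simp
    · congr 1; ring

/-! ### The backprojection integrand -/

lemma norm_sub_source_sq (D : ℝ) (x : Plane) (β : ℝ) :
    ‖x - source D β‖ ^ 2 = (D - inner ℝ x (perp β)) ^ 2 + inner ℝ x (xi β) ^ 2 := by
  have h1 : inner ℝ (perp β) (xi β) = 0 := by simp [inner_plane]; ring
  have h2 : inner ℝ (perp β) (perp β) = 1 := by simp
  rw [← inner_xi_sq_add_inner_perp_sq _ β, inner_sub_left, inner_sub_left, source_eq,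
    real_inner_smul_left, real_inner_smul_left, h1, h2]
  ring

/-- The backprojection integrand in the frame of the source: `D - x · ξ_β^⊥` is the component of
`r_β - x` along `ξ_β^⊥`, and `x · ξ_β` is the component of `x - r_β` along the detector. -/
lemma backprojectionIntegrand_eq {D : ℝ} (hD : 0 < D) (g : ℝ → ℝ → ℝ) (x : Plane) (β : ℝ) :
    backprojectionIntegrand D g x β =
      fanKernel D g (D - inner ℝ x (perp β)) (inner ℝ x (xi β)) β / ‖x - source D β‖ := by
  have hU : ratioU D x β = (D - inner ℝ x (perp β)) / D := by
    rw [ratioU, source_eq, real_inner_smul_left, real_inner_comm]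
    field_simp
  have hN : ‖x - source D β‖ =
      √((D - inner ℝ x (perp β)) ^ 2 + inner ℝ x (xi β) ^ 2) := by
    rw [← norm_sub_source_sq, Real.sqrt_sq (norm_nonneg _)]
  rw [hN]
  unfold backprojectionIntegrand heightS
  rw [hU]
  set a := D - inner ℝ x (perp β)
  set b := inner ℝ x (xi β)
  unfold fanKernel
  rcases eq_or_ne a 0 with ha | ha
  · simp [ha]
  have hab : 0 < a ^ 2 + b ^ 2 := by positivity
  have e1 : b / (a / D) = D * b / a := by field_simp
  have e2 : √((D * b / a) ^ 2 + D ^ 2) = D / |a| * √(a ^ 2 + b ^ 2) := by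
    rw [← abs_of_pos hD, ← abs_div, abs_of_pos hD, ← Real.sqrt_sq_eq_abs,
      ← Real.sqrt_mul (by positivity)]
    congr 1
    field_simp; ring
  rw [e1, e2, abs_div, abs_of_pos hD]
  have hs : √(a ^ 2 + b ^ 2) ≠ 0 := (Real.sqrt_pos.2 hab).ne'
  have hs2 : √(a ^ 2 + b ^ 2) ^ 2 = a ^ 2 + b ^ 2 := Real.sq_sqrt hab.le
  have ha' : |a| ≠ 0 := abs_ne_zero.2 ha
  rw [← sq_abs a] at *
  field_simp
  rw [hs2]

/-- The integral over the source angle converges at every point. If `|x| = D`, the integrand stays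
bounded at the source through `x` because then `|x - r_β|² = 2 D (D - x · ξ_β^⊥)`, while the
kernel vanishes to second order in `D - x · ξ_β^⊥`. -/
lemma intervalIntegrable_backprojectionIntegrand {D : ℝ} (hD : 0 < D) {g : ℝ → ℝ → ℝ}
    (hg : IsLinearSinogram g) (x : Plane) (a b : ℝ) :
    IntervalIntegrable (backprojectionIntegrand D g x) volume a b := by
  obtain ⟨C, hC, h⟩ := exists_fanKernel_le hD hg
  obtain ⟨C', hC', h'⟩ := exists_fanKernel_bounded hD hg
  have hmeas : Measurable (backprojectionIntegrand D g x) := by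
    simp only [funext (backprojectionIntegrand_eq hD g x)]
    exact (measurable_fanKernel D hg (by fun_prop) (by fun_prop) (by fun_prop)).div (by fun_prop)
  suffices hb : ∃ M, ∀ β, ‖backprojectionIntegrand D g x β‖ ≤ M by
    obtain ⟨M, hM⟩ := hb
    exact (intervalIntegrable_const (c := M)).mono_fun hmeas.aestronglyMeasurable
      (Eventually.of_forall fun β => (hM β).trans (le_abs_self M))
  simp only [backprojectionIntegrand_eq hD g x, norm_div, Real.norm_eq_abs, abs_norm]
  by_cases hx : ‖x‖ = D
  · refine ⟨C / (2 * D), fun β => ?_⟩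
    set N := ‖x - source D β‖ with hNdef
    set u := D - inner ℝ x (perp β) with hu
    set p := inner ℝ x (xi β) with hp
    have hN2 : u ^ 2 + p ^ 2 = N ^ 2 := (norm_sub_source_sq D x β).symm
    have hN3 : N ^ 2 = 2 * D * u := by
      have := inner_xi_sq_add_inner_perp_sq x β
      rw [hx] at this
      rw [← hN2, hu]; linear_combination this
    have hN : N ≤ 2 * D := by
      calc N ≤ ‖x‖ + ‖source D β‖ := norm_sub_le _ _
        _ = 2 * D := by rw [hx, norm_source hD]; ring
    have hN0 : 0 ≤ N := norm_nonneg _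
    rcases hN0.eq_or_lt with h0 | h0
    · rw [← h0]; simp; positivity
    have hk := h u p β
    rw [hN2] at hk
    rw [div_le_div_iff₀ h0 (by positivity)]
    have hu' : u ^ 2 / N ^ 2 * (2 * D) ≤ N := by
      have : u = N ^ 2 / (2 * D) := by rw [hN3]; field_simp
      rw [this]
      have e : (N ^ 2 / (2 * D)) ^ 2 / N ^ 2 * (2 * D) = N * (N / (2 * D)) := by field_simp
      rw [e]
      exact mul_le_of_le_one_right hN0 (div_le_one_of_le₀ hN (by positivity))
    calc _ ≤ C * (u ^ 2 / N ^ 2) * (2 * D) := by gcongr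
      _ = C * (u ^ 2 / N ^ 2 * (2 * D)) := by ring
      _ ≤ C * N := by gcongr
  · refine ⟨C' / |‖x‖ - D|, fun β => ?_⟩
    have h1 : |‖x‖ - D| ≤ ‖x - source D β‖ := by
      simpa [norm_source hD] using abs_norm_sub_norm_le x (source D β)
    have h2 : 0 < |‖x‖ - D| := abs_pos.2 (sub_ne_zero.2 hx)
    exact div_le_div₀ hC' (h' _ _ _) h2 h1

/-! ### Coordinates on the plane -/

/-- The linear isometry of the plane that takes the standard basis to `ξ_θ, ξ_θ^⊥`. -/
def rotation (θ : ℝ) : Plane ≃ₗᵢ[ℝ] Plane :=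
  LinearIsometry.toLinearIsometryEquiv
    { toFun := fun x => x 0 • xi θ + x 1 • perp θ
      map_add' := fun x y => by simp only [PiLp.add_apply, add_smul]; abel
      map_smul' := fun c x => by simp [mul_smul]
      norm_map' := fun x => by
        refine (sq_eq_sq₀ (norm_nonneg _) (norm_nonneg _)).1 ?_
        simp only [norm_sq_plane, LinearMap.coe_mk, AddHom.coe_mk, PiLp.add_apply, PiLp.smul_apply,
          xi_zero, xi_one, perp_zero, perp_one, smul_eq_mul]
        linear_combination (x 0 ^ 2 + x 1 ^ 2) * Real.sin_sq_add_cos_sq θ } rfl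

/-- The measurable identification of `ℝ × ℝ` with the plane. -/
def ofProd : ℝ × ℝ ≃ᵐ Plane :=
  MeasurableEquiv.finTwoArrow.symm.trans (MeasurableEquiv.toLp 2 (Fin 2 → ℝ))

lemma ofProd_apply (p : ℝ × ℝ) : ofProd p = !₂[p.1, p.2] := rfl

lemma measurePreserving_ofProd : MeasurePreserving ofProd :=
  (PiLp.volume_preserving_toLp (Fin 2)).comp (volume_preserving_finTwoArrow ℝ).symm

/-- Orthogonal coordinates `(a, b) ↦ a ξ_θ + b ξ_θ^⊥`. -/
def frame (θ : ℝ) : ℝ × ℝ ≃ᵐ Plane :=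
  ofProd.trans (rotation θ).toHomeomorph.toMeasurableEquiv

lemma frame_apply (θ : ℝ) (p : ℝ × ℝ) : frame θ p = p.1 • xi θ + p.2 • perp θ := rfl

lemma measurePreserving_frame (θ : ℝ) : MeasurePreserving (frame θ) :=
  (rotation θ).measurePreserving.comp measurePreserving_ofProd

lemma norm_sq_frame (θ : ℝ) (p : ℝ × ℝ) : ‖frame θ p‖ ^ 2 = p.1 ^ 2 + p.2 ^ 2 := by
  change ‖rotation θ (ofProd p)‖ ^ 2 = _
  rw [LinearIsometryEquiv.norm_map, norm_sq_plane]
  rfl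

lemma ofProd_polarCoord_symm (p : ℝ × ℝ) : ofProd (polarCoord.symm p) = p.1 • xi p.2 := by
  rw [ofProd_apply, polarCoord_symm_apply]
  ext i; fin_cases i <;> simp [xi]

section Polar

variable {E : Type*} [NormedAddCommGroup E] [NormedSpace ℝ E]

lemma integral_polar (f : Plane → E) :
    ∫ p in Set.Ioi (0 : ℝ) ×ˢ Set.Ioo (-Real.pi) Real.pi, p.1 • f (p.1 • xi p.2) = ∫ x, f x := by
  rw [← measurePreserving_ofProd.integral_comp ofProd.measurableEmbedding,
    ← integral_comp_polarCoord_symm]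
  simp only [ofProd_polarCoord_symm]
  rfl

lemma integrableOn_polar {f : Plane → E} (hf : Integrable f) :
    IntegrableOn (fun p : ℝ × ℝ => p.1 • f (p.1 • xi p.2))
      (Set.Ioi (0 : ℝ) ×ˢ Set.Ioo (-Real.pi) Real.pi) := by
  have h1 : Integrable (fun p => f (ofProd p)) :=
    (measurePreserving_ofProd.integrable_comp_emb ofProd.measurableEmbedding).2 hf
  have h2 := (integrableOn_image_iff_integrableOn_abs_det_fderiv_smul volume
    polarCoord.open_target.measurableSet
    (fun p _ => (hasFDerivAt_polarCoord_symm p).hasFDerivWithinAt) polarCoord.symm.injOn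
    (fun p => f (ofProd p))).1 h1.integrableOn
  refine h2.congr_fun (fun p hp => ?_) polarCoord.open_target.measurableSet
  simp only [det_fderivPolarCoordSymm, ofProd_polarCoord_symm, abs_of_pos (show 0 < p.1 from hp.1)]

/-- Polar coordinates with a signed radius: as `θ` runs through `(-π, π)`, the lines `ℝ ξ_θ` cover
the plane twice. -/
lemma integral_signed_polar {f : Plane → E} (hf : Integrable f) :
    ∫ θ in (-Real.pi)..Real.pi, ∫ t : ℝ, |t| • f (t • xi θ) = (2 : ℝ) • ∫ x, f x := by
  have hpos : ∀ {f : Plane → E}, Integrable f →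
      Integrable (Function.uncurry fun θ t : ℝ => t • f (t • xi θ))
        ((volume.restrict (Set.Ioo (-Real.pi) Real.pi)).prod
          (volume.restrict (Set.Ioi (0 : ℝ)))) := by
    intro f hf
    have := integrableOn_polar hf
    rw [IntegrableOn, Measure.volume_eq_prod, ← Measure.prod_restrict] at this
    exact this.swap
  have hint : ∀ {f : Plane → E}, Integrable f →
      ∫ x, f x = ∫ θ in Set.Ioo (-Real.pi) Real.pi, ∫ t in Set.Ioi (0 : ℝ), t • f (t • xi θ) := by
    intro f hf
    rw [integral_integral (hpos hf), ← integral_polar, Measure.volume_eq_prod,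
      ← Measure.prod_restrict, ← integral_prod_swap]
    rfl
  have hf' : Integrable fun x => f (-x) := hf.comp_neg
  have hp1 := hpos hf
  have hp2 := hpos hf'
  have q1 : Integrable (fun θ => ∫ t in Set.Ioi (0 : ℝ), t • f (t • xi θ))
      (volume.restrict (Set.Ioo (-Real.pi) Real.pi)) := hp1.integral_prod_left
  have q2 : Integrable (fun θ => ∫ t in Set.Ioi (0 : ℝ), t • f (-(t • xi θ)))
      (volume.restrict (Set.Ioo (-Real.pi) Real.pi)) := hp2.integral_prod_left
  -- One copy of `∫ f` supplies the positive radii, the other one, as `∫ f (-x)`, the negative ones.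
  rw [two_smul]
  nth_rewrite 2 [← integral_neg_eq_self]
  rw [hint hf, hint hf', ← integral_add q1 q2,
    intervalIntegral.integral_of_le (by linarith [Real.pi_pos]), integral_Ioc_eq_integral_Ioo]
  refine integral_congr_ae ?_
  filter_upwards [hp1.prod_right_ae, hp2.prod_right_ae] with θ h1 h2
  simp only [Function.uncurry_apply_pair] at h1 h2
  have e1 : ∀ t ∈ Set.Ioi (0 : ℝ), t • f (t • xi θ) = |t| • f (t • xi θ) := fun t ht => by
    rw [abs_of_pos ht]
  have e2 : ∀ t ∈ Set.Ioi (0 : ℝ), t • f (-(t • xi θ)) = |-t| • f ((-t) • xi θ) := fun t ht => by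
    rw [abs_neg, abs_of_pos ht, neg_smul]
  have i1 : IntegrableOn (fun t : ℝ => |t| • f (t • xi θ)) (Set.Ioi 0) :=
    IntegrableOn.congr_fun h1 e1 measurableSet_Ioi
  have i2 : IntegrableOn (fun t : ℝ => |-t| • f ((-t) • xi θ)) (Set.Ioi 0) :=
    IntegrableOn.congr_fun h2 e2 measurableSet_Ioi
  have i3 : IntegrableOn (fun t : ℝ => |t| • f (t • xi θ)) (Set.Iic 0) := by
    rw [integrableOn_Iic_iff_integrableOn_Iio,
      ← (Measure.measurePreserving_neg (volume : Measure ℝ)).integrableOn_comp_preimage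
        (Homeomorph.neg ℝ).measurableEmbedding]
    simpa only [Set.neg_preimage, Set.neg_Iio, neg_zero] using! i2
  rw [setIntegral_congr_fun measurableSet_Ioi e1, setIntegral_congr_fun measurableSet_Ioi e2,
    integral_comp_neg_Ioi (f := fun t : ℝ => |t| • f (t • xi θ)), neg_zero, add_comm,
    ← setIntegral_union (Set.Iic_disjoint_Ioi le_rfl) measurableSet_Ioi i3 i1, Set.Iic_union_Ioi,
    setIntegral_univ]

end Polar

/-! ### Decay of Schwartz functions -/

/-- A Schwartz function on the plane is dominated by `(1 + |x|²)⁻²`. -/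
lemma exists_schwartz_le (φ : 𝓢(Plane, ℂ)) :
    ∃ C, 0 ≤ C ∧ ∀ x, ‖φ x‖ ≤ C * ((1 + ‖x‖ ^ 2) ^ 2)⁻¹ := by
  obtain ⟨C₀, -, h₀⟩ := φ.decay 0 0
  obtain ⟨C₄, -, h₄⟩ := φ.decay 4 0
  simp only [norm_iteratedFDeriv_zero] at h₀ h₄
  have hC₀ : 0 ≤ C₀ := le_trans (by positivity) (h₀ 0)
  have hC₄ : 0 ≤ C₄ := le_trans (by positivity) (h₄ 0)
  refine ⟨2 * (C₀ + C₄), by positivity, fun x => ?_⟩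
  rw [← div_eq_mul_inv, le_div_iff₀ (by positivity)]
  have e₀ := h₀ x
  have e₄ := h₄ x
  have h1 : (1 + ‖x‖ ^ 2) ^ 2 ≤ 2 * (1 + ‖x‖ ^ 4) := by nlinarith [sq_nonneg (1 - ‖x‖ ^ 2)]
  have h2 := mul_le_mul_of_nonneg_left h1 (norm_nonneg (φ x))
  simp only [pow_zero, one_mul] at e₀
  linarith

lemma exists_schwartz_frame_le (φ : 𝓢(Plane, ℂ)) :
    ∃ C, 0 ≤ C ∧ ∀ θ a b : ℝ,
      ‖φ (a • xi θ + b • perp θ)‖ ≤ C * ((1 + a ^ 2)⁻¹ * (1 + b ^ 2)⁻¹) := by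
  obtain ⟨C, hC, h⟩ := exists_schwartz_le φ
  refine ⟨C, hC, fun θ a b => ?_⟩
  have := h (frame θ (a, b))
  rw [norm_sq_frame] at this
  refine this.trans ?_
  rw [← mul_inv]
  gcongr
  nlinarith [sq_nonneg a, sq_nonneg b, mul_nonneg (sq_nonneg a) (sq_nonneg b)]

/-! ### The Fourier transform of Schwartz functions along lines -/

lemma norm_exp_neg_I_mul (r : ℝ) : ‖Complex.exp (-(Complex.I * r))‖ = 1 := by
  rw [← mul_neg, ← Complex.ofReal_neg, mul_comm, Complex.norm_exp_ofReal_mul_I]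

open scoped FourierTransform in
lemma planeFourier_eq (φ : Plane → ℂ) (x : Plane) :
    planeFourier φ x = 1 / (2 * (Real.pi : ℂ)) * 𝓕 φ ((2 * Real.pi)⁻¹ • x) := by
  rw [planeFourier, Real.fourier_eq']
  congr 2
  ext y
  rw [smul_eq_mul, real_inner_smul_right, real_inner_comm]
  congr 2
  push_cast
  have : (Real.pi : ℂ) ≠ 0 := by exact_mod_cast Real.pi_ne_zero
  field_simp

/-- The Fourier transform of a Schwartz function is a Schwartz function. -/
lemma exists_schwartz_planeFourier (φ : 𝓢(Plane, ℂ)) :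
    ∃ ψ : 𝓢(Plane, ℂ), ∀ x, ψ x = planeFourier (fun ω => φ ω) x := by
  have h : (2 * Real.pi)⁻¹ ≠ 0 := by positivity
  refine ⟨(1 / (2 * (Real.pi : ℂ))) • SchwartzMap.compCLMOfContinuousLinearEquiv ℂ
    (ContinuousLinearEquiv.smulLeft (Units.mk0 _ h))
    (SchwartzMap.fourierTransformCLM ℂ φ), fun x => ?_⟩
  rw [planeFourier_eq]
  rfl

/-- The Fourier slice theorem: the integral of `φ̂` along the line `x · ξ_θ = p` is the
one-dimensional Fourier transform at `p` of the restriction of `φ` to `ℝ ξ_θ`. -/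
lemma integral_planeFourier_line (φ : 𝓢(Plane, ℂ)) (θ p : ℝ) :
    ∫ t : ℝ, planeFourier (fun ω => φ ω) (p • xi θ + t • perp θ) =
      ∫ σ : ℝ, φ (σ • xi θ) * Complex.exp (-(Complex.I * (σ * p : ℝ))) := by
  obtain ⟨C, hC, hφ⟩ := exists_schwartz_frame_le φ
  obtain ⟨ψ, hψ⟩ := exists_schwartz_planeFourier φ
  obtain ⟨C', hC', hψ'⟩ := exists_schwartz_frame_le ψ
  have hexp := norm_exp_neg_I_mul
  -- `G b` is the transform at `p` of the restriction of `φ` to the line `ℝ ξ_θ + b ξ_θ^⊥`.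
  set G : ℝ → ℂ := fun b => ∫ a : ℝ, φ (a • xi θ + b • perp θ) *
    Complex.exp (-(Complex.I * (a * p : ℝ))) with hG
  have hbound : ∀ a b : ℝ, ‖φ (a • xi θ + b • perp θ) * Complex.exp (-(Complex.I * (a * p : ℝ)))‖
      ≤ C * ((1 + a ^ 2)⁻¹ * (1 + b ^ 2)⁻¹) := fun a b => by
    rw [norm_mul, hexp, mul_one]; exact hφ θ a b
  have hmajor : Integrable (fun q : ℝ × ℝ => C * ((1 + q.1 ^ 2)⁻¹ * (1 + q.2 ^ 2)⁻¹)) :=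
    (integrable_inv_one_add_sq.mul_prod integrable_inv_one_add_sq).const_mul C
  have hint : Integrable (fun q : ℝ × ℝ => φ (q.1 • xi θ + q.2 • perp θ) *
      Complex.exp (-(Complex.I * (q.1 * p : ℝ)))) :=
    hmajor.mono' (Continuous.aestronglyMeasurable (by have := φ.continuous; fun_prop))
      (Eventually.of_forall fun q => hbound q.1 q.2)
  have hGint : Integrable G := hint.integral_prod_right
  have hGcont : Continuous G := by
    refine continuous_of_dominated (bound := fun a => C * (1 + a ^ 2)⁻¹)
      (fun b => Continuous.aestronglyMeasurable (by have := φ.continuous; fun_prop))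
      (fun b => Eventually.of_forall fun a => (hbound a b).trans ?_)
      (integrable_inv_one_add_sq.const_mul C)
      (Eventually.of_forall fun a => by have := φ.continuous; fun_prop)
    gcongr
    refine mul_le_of_le_one_right (by positivity) (inv_le_one_of_one_le₀ ?_)
    nlinarith [sq_nonneg b]
  -- Up to scaling, the transform of `G` is `φ̂` on the line, so `G 0` is recovered by inversion.
  open scoped FourierTransform in
  have hFG : ∀ t : ℝ, 𝓕 G t = 2 * (Real.pi : ℂ) * ψ (p • xi θ + (2 * Real.pi * t) • perp θ) := by
    intro t
    have hpi : (2 * (Real.pi : ℂ)) ≠ 0 := by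
      simp [Real.pi_ne_zero]
    rw [hψ, planeFourier, Real.fourier_real_eq_integral_exp_smul, ← mul_assoc,
      mul_one_div_cancel hpi, one_mul,
      ← (measurePreserving_frame θ).integral_comp (frame θ).measurableEmbedding,
      Measure.volume_eq_prod, integral_prod_symm]
    · refine integral_congr_ae (Eventually.of_forall fun b => ?_)
      simp only [hG, smul_eq_mul]
      rw [← integral_const_mul]
      refine integral_congr_ae (Eventually.of_forall fun a => ?_)
      simp only [frame_apply]
      have e : inner ℝ (p • xi θ + (2 * Real.pi * t) • perp θ) (a • xi θ + b • perp θ)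
          = a * p + 2 * Real.pi * t * b := by
        simp only [inner_plane, PiLp.add_apply, PiLp.smul_apply, smul_eq_mul,
          xi_zero, xi_one, perp_zero, perp_one]
        linear_combination (a * p + 2 * Real.pi * t * b) * Real.sin_sq_add_cos_sq θ
      rw [e, mul_left_comm, ← Complex.exp_add, mul_comm]
      congr 2
      push_cast; ring
    · have hc : Integrable (fun q : ℝ × ℝ => φ (frame θ q)) :=
        ((measurePreserving_frame θ).integrable_comp_emb (frame θ).measurableEmbedding).2
          φ.integrable
      refine hc.bdd_mul (c := 1) (Continuous.aestronglyMeasurable ?_)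
        (Eventually.of_forall fun q => (hexp _).le)
      simp only [frame_apply]; fun_prop
  have hψint : Integrable fun t : ℝ => ψ (p • xi θ + t • perp θ) := by
    refine (integrable_inv_one_add_sq.const_mul C').mono'
      (Continuous.aestronglyMeasurable (by have := ψ.continuous; fun_prop))
      (Eventually.of_forall fun t => (hψ' θ p t).trans ?_)
    gcongr
    refine mul_le_of_le_one_left (by positivity) (inv_le_one_of_one_le₀ ?_)
    nlinarith [sq_nonneg p]
  open scoped FourierTransform in
  have hinv := congrFun (hGcont.fourierInv_fourier_eq hGint (by
    rw [funext hFG]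
    exact (hψint.comp_mul_left' (by positivity : 2 * Real.pi ≠ 0)).const_mul _)) 0
  rw [Real.fourierInv_eq] at hinv
  simp only [inner_zero_right, AddChar.map_zero_eq_one, one_smul] at hinv
  have h0 : G 0 = ∫ σ : ℝ, φ (σ • xi θ) * Complex.exp (-(Complex.I * (σ * p : ℝ))) := by
    simp [hG]
  rw [← h0, ← hinv, funext hFG, integral_const_mul,
    Measure.integral_comp_mul_left (fun t => ψ (p • xi θ + t • perp θ)) (2 * Real.pi),
    abs_of_pos (by positivity), Complex.real_smul, ← mul_assoc]
  have hpi : (Real.pi : ℂ) ≠ 0 := by exact_mod_cast Real.pi_ne_zero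
  simp only [← hψ]
  push_cast
  field_simp

/-- The slice theorem for the line through `r` in the direction `ξ_θ^⊥`. -/
lemma integral_planeFourier_line_through (φ : 𝓢(Plane, ℂ)) (θ : ℝ) (r : Plane) :
    ∫ t : ℝ, planeFourier (fun ω => φ ω) (r + t • perp θ) =
      ∫ σ : ℝ, φ (σ • xi θ) * Complex.exp (-(Complex.I * (inner ℝ (σ • xi θ) r : ℝ))) := by
  have hr : r = inner ℝ r (xi θ) • xi θ + inner ℝ r (perp θ) • perp θ := by
    ext i
    fin_cases i
    · simp [inner_plane]; linear_combination (-r 0) * Real.sin_sq_add_cos_sq θ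
    · simp [inner_plane]; linear_combination (-r 1) * Real.sin_sq_add_cos_sq θ
  simp only [real_inner_smul_left, real_inner_comm r (xi θ)]
  rw [← integral_planeFourier_line, ← integral_add_left_eq_self _ (-inner ℝ r (perp θ))]
  refine integral_congr_ae (Eventually.of_forall fun t => ?_)
  have : r + -inner ℝ r (perp θ) • perp θ = inner ℝ r (xi θ) • xi θ := by
    rw [neg_smul, ← sub_eq_add_neg, sub_eq_iff_eq_add]
    exact hr
  simp only
  rw [add_smul, ← add_assoc, this]

/-! ### Domination by the Riesz kernel -/

/-- An integrable radial majorant with the singularity `1 / |x|` at the origin. -/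
def rieszMajorant (x : Plane) : ℝ := ‖x‖⁻¹ * (1 + ‖x‖ ^ 2)⁻¹

lemma rieszMajorant_nonneg (x : Plane) : 0 ≤ rieszMajorant x := by
  unfold rieszMajorant; positivity

lemma integrable_rieszMajorant : Integrable rieszMajorant := by
  refine (integrable_fun_norm_addHaar volume (f := fun r : ℝ => r⁻¹ * (1 + r ^ 2)⁻¹)).2 ?_
  rw [show Module.finrank ℝ Plane = 2 by simp]
  refine integrable_inv_one_add_sq.integrableOn.congr_fun (fun r hr => ?_) measurableSet_Ioi
  have : r ≠ 0 := (show 0 < r from hr).ne'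
  simp [this]

lemma integrable_of_le_rieszMajorant {f : Plane → ℂ} (hf : Measurable f) {M : ℝ} {c : Plane}
    (h : ∀ x, ‖f x‖ ≤ M * rieszMajorant (x - c)) : Integrable f :=
  ((integrable_rieszMajorant.comp_sub_right c).const_mul M).mono' hf.aestronglyMeasurable
    (Eventually.of_forall h)

lemma integrable_prod_of_le_rieszMajorant {μ : Measure ℝ} [IsFiniteMeasure μ] {f : ℝ → Plane → ℂ}
    (hf : Measurable (Function.uncurry f)) {M : ℝ} {c : ℝ → Plane} (hc : Measurable c)
    (h : ∀ β x, ‖f β x‖ ≤ M * rieszMajorant (x - c β)) :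
    Integrable (Function.uncurry f) (μ.prod volume) := by
  have hm : Measurable rieszMajorant := by unfold rieszMajorant; fun_prop
  have key : Integrable (fun p : ℝ × Plane => rieszMajorant (p.2 - c p.1)) (μ.prod volume) := by
    rw [integrable_prod_iff (Measurable.aestronglyMeasurable (by fun_prop))]
    refine ⟨Eventually.of_forall fun β => integrable_rieszMajorant.comp_sub_right (c β), ?_⟩
    simp only [Real.norm_of_nonneg (rieszMajorant_nonneg _),
      integral_sub_right_eq_self (μ := (volume : Measure Plane)) rieszMajorant]
    exact integrable_const _
  exact (key.const_mul M).mono' hf.aestronglyMeasurable (Eventually.of_forall fun p => h p.1 p.2)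

/-- A Schwartz function divided by `|x - r|`, with `r` in a bounded set, is dominated by a translate
of one integrable function. -/
lemma exists_schwartz_div_le (φ : 𝓢(Plane, ℂ)) (R : ℝ) :
    ∃ M, 0 ≤ M ∧ ∀ x r : Plane, ‖r‖ = R → ‖φ x‖ / ‖x - r‖ ≤ M * rieszMajorant (x - r) := by
  obtain ⟨C, hC, h⟩ := exists_schwartz_le φ
  refine ⟨C * (2 * (1 + R ^ 2)), by positivity, fun x r hr => ?_⟩
  have h1 : ‖x - r‖ ^ 2 ≤ 2 * ‖x‖ ^ 2 + 2 * R ^ 2 := by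
    have := norm_sub_le x r
    rw [hr] at this
    nlinarith [norm_nonneg (x - r), sq_nonneg (‖x‖ - R)]
  have h2 : ((1 + ‖x‖ ^ 2) ^ 2)⁻¹ ≤ 2 * (1 + R ^ 2) * (1 + ‖x - r‖ ^ 2)⁻¹ := by
    rw [← div_eq_mul_inv, inv_eq_one_div, div_le_div_iff₀ (by positivity) (by positivity)]
    nlinarith [sq_nonneg ‖x‖, sq_nonneg R, mul_nonneg (sq_nonneg ‖x‖) (sq_nonneg R),
      mul_nonneg (sq_nonneg (‖x‖ ^ 2)) (sq_nonneg R), sq_nonneg (‖x‖ ^ 2)]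
  calc ‖φ x‖ / ‖x - r‖ ≤ C * (2 * (1 + R ^ 2) * (1 + ‖x - r‖ ^ 2)⁻¹) / ‖x - r‖ := by
        gcongr
        exact (h x).trans (by gcongr)
    _ = _ := by unfold rieszMajorant; ring

/-! ### The Fourier transform of a single fan -/

/-- The Fourier transform of the contribution of the source angle `β` to the backprojection: the
function `kernel / |x - r_β|` is homogeneous of degree `-1` about `r_β`, and its transform is
again homogeneous of degree `-1`, up to the phase that accounts for the translation by `r_β`. -/
def fanSpectrum (D : ℝ) (g : ℝ → ℝ → ℝ) (ω : Plane) (β : ℝ) : ℂ :=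
  ((fanKernel D g (inner ℝ ω (xi β)) (inner ℝ ω (perp β)) β / ‖ω‖ : ℝ) : ℂ) *
    Complex.exp (-(Complex.I * (inner ℝ ω (source D β) : ℝ)))

variable {D : ℝ} {g : ℝ → ℝ → ℝ}

lemma measurable_backprojectionIntegrand (hD : 0 < D) (hg : IsLinearSinogram g) :
    Measurable fun p : ℝ × Plane => backprojectionIntegrand D g p.2 p.1 := by
  simp only [backprojectionIntegrand_eq hD g]
  exact (measurable_fanKernel D hg (by fun_prop) (by fun_prop) (by fun_prop)).div (by fun_prop)

lemma measurable_fanSpectrum (hg : IsLinearSinogram g) :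
    Measurable fun p : ℝ × Plane => fanSpectrum D g p.2 p.1 := by
  unfold fanSpectrum
  have : Measurable fun p : ℝ × Plane =>
      fanKernel D g (inner ℝ p.2 (xi p.1)) (inner ℝ p.2 (perp p.1)) p.1 :=
    measurable_fanKernel D hg (by fun_prop) (by fun_prop) (by fun_prop)
  fun_prop

lemma exists_backprojectionIntegrand_mul_le (hD : 0 < D) (hg : IsLinearSinogram g)
    (φ : 𝓢(Plane, ℂ)) : ∃ M, ∀ β x, ‖(backprojectionIntegrand D g x β : ℂ) * φ x‖ ≤
      M * rieszMajorant (x - source D β) := by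
  obtain ⟨C, hC, h⟩ := exists_fanKernel_bounded hD hg
  obtain ⟨M, hM, h'⟩ := exists_schwartz_div_le φ D
  refine ⟨C * M, fun β x => ?_⟩
  rw [backprojectionIntegrand_eq hD, norm_mul, Complex.norm_real, norm_div, norm_norm,
    Real.norm_eq_abs, div_mul_eq_mul_div, mul_div_assoc, mul_assoc]
  exact mul_le_mul (h _ _ _) (h' x _ (norm_source hD β)) (by positivity) hC

lemma exists_fanSpectrum_mul_le (hD : 0 < D) (hg : IsLinearSinogram g)
    (φ : 𝓢(Plane, ℂ)) : ∃ M, ∀ β ω, ‖fanSpectrum D g ω β * φ ω‖ ≤ M * rieszMajorant (ω - 0) := by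
  obtain ⟨C, hC, h⟩ := exists_fanKernel_bounded hD hg
  obtain ⟨M, hM, h'⟩ := exists_schwartz_div_le φ 0
  refine ⟨C * M, fun β ω => ?_⟩
  have := h' ω 0 norm_zero
  rw [fanSpectrum, norm_mul, norm_mul, norm_exp_neg_I_mul, mul_one, Complex.norm_real, norm_div,
    norm_norm, Real.norm_eq_abs, div_mul_eq_mul_div, mul_div_assoc, mul_assoc]
  rw [sub_zero] at this ⊢
  exact mul_le_mul (h _ _ _) this (by positivity) hC

lemma inner_xi_xi (θ β : ℝ) : inner ℝ (xi θ) (xi β) = Real.cos (θ - β) := by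
  simp [inner_plane, Real.cos_sub]

lemma inner_xi_perp (θ β : ℝ) : inner ℝ (xi θ) (perp β) = Real.sin (θ - β) := by
  simp [inner_plane, Real.sin_sub]; ring

lemma abs_mul_backprojectionIntegrand_polar (hD : 0 < D) {t : ℝ} (ht : t ≠ 0) (θ β : ℝ) :
    |t| * backprojectionIntegrand D g (source D β + t • xi θ) β =
      fanKernel D g (-Real.sin (θ - β)) (Real.cos (θ - β)) β := by
  have h1 : inner ℝ (perp β) (xi β) = 0 := by simp [inner_plane]; ring
  have h2 : inner ℝ (perp β) (perp β) = 1 := by simp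
  have e1 : D - inner ℝ (source D β + t • xi θ) (perp β) = t * -Real.sin (θ - β) := by
    rw [inner_add_left, source_eq, real_inner_smul_left, real_inner_smul_left, inner_xi_perp, h2]
    ring
  have e2 : inner ℝ (source D β + t • xi θ) (xi β) = t * Real.cos (θ - β) := by
    rw [inner_add_left, source_eq, real_inner_smul_left, real_inner_smul_left, inner_xi_xi, h1]
    ring
  rw [backprojectionIntegrand_eq hD, e1, e2, fanKernel_smul D g ht, add_sub_cancel_left, norm_smul,
    norm_xi, mul_one, Real.norm_eq_abs, mul_div_cancel₀ _ (abs_ne_zero.2 ht)]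

lemma fanSpectrum_polar {σ : ℝ} (hσ : σ ≠ 0) (θ β : ℝ) :
    fanSpectrum D g (σ • xi θ) β =
      ((fanKernel D g (Real.cos (θ - β)) (Real.sin (θ - β)) β / |σ| : ℝ) : ℂ) *
        Complex.exp (-(Complex.I * (inner ℝ (σ • xi θ) (source D β) : ℝ))) := by
  rw [fanSpectrum, real_inner_smul_left, real_inner_smul_left, inner_xi_xi, inner_xi_perp,
    fanKernel_smul D g hσ, norm_smul, norm_xi, mul_one, Real.norm_eq_abs]

/-- In polar coordinates about the source, resp. the origin, both sides become integrals over
lines: the radial factors `1 / |x - r_β|` and `1 / |ω|` cancel the Jacobians, and the slice theorem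
identifies the integrals over the lines. -/
lemma integral_backprojectionIntegrand_mul_planeFourier (hD : 0 < D) (hg : IsLinearSinogram g)
    (φ : 𝓢(Plane, ℂ)) (β : ℝ) :
    ∫ x, (backprojectionIntegrand D g x β : ℂ) * planeFourier (fun ω => φ ω) x =
      ∫ ω, fanSpectrum D g ω β * φ ω := by
  obtain ⟨ψ, hψ⟩ := exists_schwartz_planeFourier φ
  set r := source D β with hr
  have hH : Integrable fun y => (backprojectionIntegrand D g (r + y) β : ℂ) * ψ (r + y) := by
    obtain ⟨M, hM⟩ := exists_backprojectionIntegrand_mul_le hD hg ψ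
    have hm := (measurable_backprojectionIntegrand hD hg).comp (measurable_prodMk_left (x := β))
    have : Integrable fun x => (backprojectionIntegrand D g x β : ℂ) * ψ x :=
      integrable_of_le_rieszMajorant
        ((Complex.measurable_ofReal.comp hm).mul ψ.continuous.measurable) (hM β)
    exact this.comp_add_left r
  have hS : Integrable fun ω => fanSpectrum D g ω β * φ ω := by
    obtain ⟨M, hM⟩ := exists_fanSpectrum_mul_le hD hg φ
    have hm := (measurable_fanSpectrum (D := D) hg).comp (measurable_prodMk_left (x := β))
    exact integrable_of_le_rieszMajorant (hm.mul φ.continuous.measurable) (hM β)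
  have key : (2 : ℝ) • ∫ x, (backprojectionIntegrand D g x β : ℂ) * ψ x =
      (2 : ℝ) • ∫ ω, fanSpectrum D g ω β * φ ω := by
    rw [← integral_add_left_eq_self _ r, ← integral_signed_polar hH, ← integral_signed_polar hS]
    set f : ℝ → ℂ := fun θ =>
      (fanKernel D g (-Real.sin (θ - β)) (Real.cos (θ - β)) β : ℂ) * ∫ t : ℝ, ψ (r + t • xi θ)
      with hf
    have hper : Function.Periodic f (2 * Real.pi) := fun θ => by
      have : xi (θ + 2 * Real.pi) = xi θ := by
        ext i; fin_cases i <;> simp [xi]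
      simp only [hf, this, add_sub_right_comm, Real.sin_add_two_pi, Real.cos_add_two_pi]
    have hleft : ∀ θ, ∫ t : ℝ, |t| •
        ((backprojectionIntegrand D g (r + t • xi θ) β : ℂ) * ψ (r + t • xi θ)) = f θ := by
      intro θ
      simp only [hf]
      rw [← integral_const_mul]
      refine integral_congr_ae ?_
      filter_upwards [Measure.ae_ne volume (0 : ℝ)] with t ht
      rw [← abs_mul_backprojectionIntegrand_polar hD ht, Complex.real_smul, ← mul_assoc]
      push_cast; rfl
    have hright : ∀ θ, ∫ t : ℝ, |t| • (fanSpectrum D g (t • xi θ) β * φ (t • xi θ)) =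
        f (θ + Real.pi / 2) := by
      intro θ
      have e : fanKernel D g (-Real.sin (θ + Real.pi / 2 - β)) (Real.cos (θ + Real.pi / 2 - β)) β =
          fanKernel D g (Real.cos (θ - β)) (Real.sin (θ - β)) β := by
        rw [add_sub_right_comm, Real.sin_add_pi_div_two, Real.cos_add_pi_div_two,
          ← fanKernel_smul D g (neg_ne_zero.2 one_ne_zero)]
        simp
      simp only [hf, e, xi_add_pi_div_two, hψ]
      rw [integral_planeFourier_line_through, ← integral_const_mul]
      refine integral_congr_ae ?_
      filter_upwards [Measure.ae_ne volume (0 : ℝ)] with t ht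
      rw [fanSpectrum_polar ht, Complex.real_smul]
      have : ((|t| : ℝ) : ℂ) ≠ 0 := by exact_mod_cast abs_ne_zero.2 ht
      push_cast
      field_simp
      rw [hr]
      ring
    -- The two integrals over `θ` differ by a shift by `π / 2`, over one full period.
    simp only [hleft, hright]
    rw [intervalIntegral.integral_comp_add_right]
    have := hper.intervalIntegral_add_eq (-Real.pi) (-Real.pi + Real.pi / 2)
    convert this using 2 <;> ring
  simp only [← hψ]
  exact smul_right_injective ℂ (two_ne_zero' ℝ) key

/-! ### The Fourier transform of the backprojection -/

/-- The Fourier transform of the linear backprojection, as an integral over the source angle. -/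
def backprojectionFourier (D : ℝ) (g : ℝ → ℝ → ℝ) (ω : Plane) : ℂ :=
  ∫ β in (0 : ℝ)..(2 * Real.pi), fanSpectrum D g ω β

lemma isDistributionalFourier_backprojection (hD : 0 < D) (hg : IsLinearSinogram g) :
    IsDistributionalFourier (fun x => (linearBackprojection D g x : ℂ))
      (backprojectionFourier D g) := by
  have h0 : (0 : ℝ) ≤ 2 * Real.pi := by positivity
  have hB : ∀ φ : 𝓢(Plane, ℂ),
      Integrable (Function.uncurry fun β x => (backprojectionIntegrand D g x β : ℂ) * φ x)
        ((volume.restrict (Set.Ioc 0 (2 * Real.pi))).prod volume) := fun φ => by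
    obtain ⟨M, hM⟩ := exists_backprojectionIntegrand_mul_le hD hg φ
    have hm := measurable_backprojectionIntegrand hD hg
    have hφ := φ.continuous.measurable
    exact integrable_prod_of_le_rieszMajorant
      ((Complex.measurable_ofReal.comp hm).mul (hφ.comp measurable_snd)) (by fun_prop) hM
  have hS : ∀ φ : 𝓢(Plane, ℂ),
      Integrable (Function.uncurry fun β ω => fanSpectrum D g ω β * φ ω)
        ((volume.restrict (Set.Ioc 0 (2 * Real.pi))).prod volume) := fun φ => by
    obtain ⟨M, hM⟩ := exists_fanSpectrum_mul_le hD hg φ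
    have hm := measurable_fanSpectrum (D := D) hg
    have hφ := φ.continuous.measurable
    exact integrable_prod_of_le_rieszMajorant
      (hm.mul (hφ.comp measurable_snd)) (c := fun _ => 0) (by fun_prop) hM
  have eB : ∀ (u : Plane → ℂ) (x : Plane), (linearBackprojection D g x : ℂ) * u x =
      ∫ β in Set.Ioc 0 (2 * Real.pi), (backprojectionIntegrand D g x β : ℂ) * u x := fun u x => by
    rw [linearBackprojection, ← intervalIntegral.integral_ofReal,
      intervalIntegral.integral_of_le h0, integral_mul_const]
  have eS : ∀ (u : Plane → ℂ) (ω : Plane), backprojectionFourier D g ω * u ω =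
      ∫ β in Set.Ioc 0 (2 * Real.pi), fanSpectrum D g ω β * u ω := fun u ω => by
    rw [backprojectionFourier, intervalIntegral.integral_of_le h0, integral_mul_const]
  refine ⟨fun φ => ?_, fun φ => ?_, fun φ => ?_⟩
  · simp only [eB φ]
    exact (hB φ).integral_prod_right
  · simp only [eS φ]
    exact (hS φ).integral_prod_right
  · obtain ⟨ψ, hψ⟩ := exists_schwartz_planeFourier φ
    simp only [← hψ]
    simp only [eB ψ, eS φ]
    rw [← integral_integral_swap (hB ψ), ← integral_integral_swap (hS φ)]
    simp only [hψ, integral_backprojectionIntegrand_mul_planeFourier hD hg]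

lemma continuousOn_backprojectionFourier (hD : 0 < D) (hg : IsLinearSinogram g) :
    ContinuousOn (backprojectionFourier D g) {0}ᶜ := by
  rw [continuousOn_iff_continuous_domRestrict]
  refine intervalIntegral.continuous_parametric_intervalIntegral_of_continuous'
    (f := fun (ω : ({0}ᶜ : Set Plane)) β => fanSpectrum D g ω β) ?_ _ _
  have hne : ∀ p : ({0}ᶜ : Set Plane) × ℝ, ‖(p.1 : Plane)‖ ≠ 0 := fun p => norm_ne_zero_iff.2 p.1.2
  have hk : Continuous fun p : ({0}ᶜ : Set Plane) × ℝ =>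
      fanKernel D g (inner ℝ (p.1 : Plane) (xi p.2)) (inner ℝ (p.1 : Plane) (perp p.2)) p.2 := by
    refine Continuous.fanKernel hD hg (by fun_prop) (by fun_prop) (by fun_prop) fun p => ?_
    rw [inner_xi_sq_add_inner_perp_sq]
    exact pow_ne_zero 2 (hne p)
  unfold fanSpectrum
  exact (Complex.continuous_ofReal.comp (hk.div (by fun_prop) hne)).mul (by fun_prop)

/-- Along the ray at angle `θ`, the substitution `γ = θ - β` turns the integral over the source
angle into one over the rebinned and sheared data. -/
lemma backprojectionFourier_polar (hg : IsLinearSinogram g) {σ : ℝ} (hσ : 0 < σ) (θ : ℝ) :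
    backprojectionFourier D g (σ • xi θ) =
      1 / (σ : ℂ) * ∫ γ in (0 : ℝ)..(2 * Real.pi),
        (fanKernel D g (Real.cos γ) (Real.sin γ) (θ - γ) : ℂ) *
          Complex.exp (-(Complex.I * (D * σ * Real.sin γ : ℝ))) := by
  set f : ℝ → ℂ := fun γ => (fanKernel D g (Real.cos γ) (Real.sin γ) (θ - γ) : ℂ) *
    Complex.exp (-(Complex.I * (D * σ * Real.sin γ : ℝ))) with hf
  have hper : Function.Periodic f (2 * Real.pi) := fun γ => by
    simp only [hf, Real.sin_add_two_pi, Real.cos_add_two_pi, fanKernel]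
    rw [← hg.periodic _ (θ - (γ + 2 * Real.pi))]
    congr 4; ring
  have h : ∀ β, fanSpectrum D g (σ • xi θ) β = 1 / (σ : ℂ) * f (θ - β) := fun β => by
    rw [fanSpectrum_polar hσ.ne', abs_of_pos hσ, source_eq, real_inner_smul_left,
      real_inner_smul_right, inner_xi_perp, hf]
    simp only [sub_sub_cancel]
    rw [mul_left_comm σ, ← mul_assoc]
    push_cast; ring
  rw [backprojectionFourier]
  simp only [h]
  rw [intervalIntegral.integral_const_mul, intervalIntegral.integral_comp_sub_left]
  congr 1
  have := hper.intervalIntegral_add_eq (θ - 2 * Real.pi) 0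
  simpa using this

/-! ### The Jacobi–Anger expansion -/

/-- The terms of the Jacobi–Anger expansion: the frequencies `n` and `-n` are combined into one
term, the Bessel functions of order `n` and `-n` differing by the sign `(-1)^n`. -/
def angerTerm (n : ℕ) (γ : ℝ) : ℂ :=
  if n = 0 then 1
  else Complex.exp (-(Complex.I * n * γ)) + (-1) ^ n * Complex.exp (Complex.I * n * γ)

lemma norm_angerTerm_le (n : ℕ) (γ : ℝ) : ‖angerTerm n γ‖ ≤ 2 := by
  have h : ∀ r : ℝ, ‖Complex.exp (Complex.I * r)‖ = 1 := fun r => by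
    rw [mul_comm, Complex.norm_exp_ofReal_mul_I]
  unfold angerTerm
  split_ifs
  · simp
  · refine (norm_add_le _ _).trans ?_
    have h1 := h (n * γ)
    have h2 := norm_exp_neg_I_mul (n * γ)
    push_cast at h1 h2
    rw [norm_mul, mul_assoc, h1, h2]
    simp; norm_num

@[fun_prop] lemma continuous_angerTerm (n : ℕ) : Continuous (angerTerm n) := by
  unfold angerTerm
  split_ifs <;> fun_prop

/-- The terms of the power series of the Bessel functions. -/
def besselTerm (x : ℝ) (n k : ℕ) : ℝ :=
  (-1) ^ k / ((k.factorial : ℝ) * ((n + k).factorial : ℝ)) * (x / 2) ^ (2 * k + n)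

lemma besselTerm_eq (x : ℝ) (n k : ℕ) :
    besselTerm x n k = (-(x / 2)) ^ k / k.factorial * ((x / 2) ^ (n + k) / (n + k).factorial) := by
  unfold besselTerm
  rw [neg_pow (x / 2), show 2 * k + n = k + (n + k) by ring, pow_add (x / 2) k]
  ring

lemma summable_besselTerm (x : ℝ) : Summable fun p : ℕ × ℕ => ‖besselTerm x p.1 p.2‖ := by
  have h := (Real.summable_pow_div_factorial (x / 2)).norm.mul_of_nonneg
    (Real.summable_pow_div_factorial (-(x / 2))).norm (fun _ => norm_nonneg _)
    fun _ => norm_nonneg _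
  have hinj : Function.Injective fun p : ℕ × ℕ => (p.1 + p.2, p.2) := fun p q hpq => by
    simp only [Prod.mk.injEq] at hpq
    ext <;> omega
  refine (h.comp_injective hinj).congr fun p => ?_
  rw [besselTerm_eq, norm_mul, mul_comm]
  rfl

lemma summable_norm_besselJ (x : ℝ) : Summable fun n => ‖besselJ n x‖ := by
  have h := summable_besselTerm x
  refine Summable.of_nonneg_of_le (fun _ => norm_nonneg _) (fun n => ?_) h.prod
  exact norm_tsum_le_tsum_norm (h.prod_factor n)

/-- The pairs `(j, k)` of naturals, sorted by the difference `j - k`: the pair `(n, k)` in the first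
summand stands for `(n + k, k)`, in the second one for `(k, n + 1 + k)`. -/
def diffEquiv : (ℕ × ℕ) ⊕ (ℕ × ℕ) ≃ ℕ × ℕ :=
  Equiv.ofBijective
    (Sum.elim (fun p => (p.1 + p.2, p.2)) fun p => (p.2, p.1 + 1 + p.2)) <| by
    constructor
    · rintro (⟨a, b⟩ | ⟨a, b⟩) (⟨c, d⟩ | ⟨c, d⟩) h <;>
        simp only [Sum.elim_inl, Sum.elim_inr, Prod.mk.injEq] at h <;>
        simp <;> omega
    · rintro ⟨j, k⟩
      rcases le_or_gt k j with h | h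
      · exact ⟨Sum.inl (j - k, k), by simp; omega⟩
      · exact ⟨Sum.inr (k - j - 1, j), by simp; omega⟩

lemma hasSum_exp_add (u v : ℂ) :
    HasSum (fun p : ℕ × ℕ => u ^ p.1 / p.1.factorial * (v ^ p.2 / p.2.factorial))
      (Complex.exp (u + v)) := by
  rw [Complex.exp_add, Complex.exp_eq_exp_ℂ]
  have h := (NormedSpace.expSeries_div_hasSum_exp u).mul (g := fun n : ℕ => v ^ n / n.factorial)
    (NormedSpace.expSeries_div_hasSum_exp v) (summable_mul_of_summable_norm
      (f := fun n : ℕ => u ^ n / n.factorial) (g := fun n : ℕ => v ^ n / n.factorial)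
      (NormedSpace.norm_expSeries_div_summable u) (NormedSpace.norm_expSeries_div_summable v))
  simpa only using h

/-- Summing over the second index of the Bessel terms of orders at least `m`. -/
lemma hasSum_besselJ_mul {x : ℝ} {c : ℕ → ℂ} {m : ℕ} {S : ℂ}
    (h : HasSum (fun p : ℕ × ℕ => (besselTerm x (p.1 + m) p.2 : ℂ) * c (p.1 + m)) S) :
    HasSum (fun n => (besselJ (n + m) x : ℂ) * c (n + m)) S := by
  have hJ : ∀ n, HasSum (fun k => ((besselTerm x n k : ℝ) : ℂ)) (besselJ n x) := fun n =>
    Complex.hasSum_ofReal.2 ((summable_besselTerm x).of_norm.prod_factor n).hasSum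
  have h' : ∀ n, HasSum (fun k => (besselTerm x (n + m) k : ℂ) * c (n + m))
      ((besselJ (n + m) x : ℂ) * c (n + m)) := fun n => (hJ (n + m)).mul_right _
  exact h.prod_fiberwise h'

/-- The Jacobi–Anger expansion of `exp (-i x sin γ)`. It is the product of the exponential series
of `(x / 2) e^{-iγ}` and `-(x / 2) e^{iγ}`, sorted by frequency. -/
lemma hasSum_jacobiAnger (x γ : ℝ) :
    HasSum (fun n : ℕ => (besselJ n x : ℂ) * angerTerm n γ)
      (Complex.exp (-(Complex.I * (x * Real.sin γ : ℝ)))) := by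
  set e : ℂ := Complex.exp (Complex.I * γ) with he
  set e' : ℂ := Complex.exp (-(Complex.I * γ)) with he'
  have hee : e * e' = 1 := by rw [he, he', ← Complex.exp_add]; simp
  set u : ℂ := (x / 2 : ℝ) * e' with hu
  set v : ℂ := -((x / 2 : ℝ) * e) with hv
  have huv : u + v = -(Complex.I * (x * Real.sin γ : ℝ)) := by
    rw [hu, hv, he, he']
    push_cast
    rw [Complex.sin, mul_comm Complex.I (γ : ℂ), ← neg_mul]
    linear_combination ((x : ℂ) / 2 *
      (Complex.exp (-γ * Complex.I) - Complex.exp (γ * Complex.I))) * Complex.I_sq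
  have hprod := hasSum_exp_add u v
  rw [huv] at hprod
  have hterm : ∀ n k : ℕ, u ^ (n + k) / (n + k).factorial * (v ^ k / k.factorial) =
      besselTerm x n k * e' ^ n := fun n k => by
    rw [besselTerm_eq, hu, hv, neg_pow, mul_pow, mul_pow, pow_add e']
    have : e ^ k * e' ^ k = 1 := by rw [← mul_pow, hee, one_pow]
    push_cast
    rw [neg_pow ((x : ℂ) / 2)]
    linear_combination ((x / 2 : ℂ) ^ (n + k) / (n + k).factorial * e' ^ n *
      ((-1) ^ k * (x / 2 : ℂ) ^ k / k.factorial)) * this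
  have hterm' : ∀ n k : ℕ, u ^ k / k.factorial * (v ^ (n + k) / (n + k).factorial) =
      besselTerm x n k * ((-1) ^ n * e ^ n) := fun n k => by
    rw [besselTerm_eq, hu, hv, neg_pow, mul_pow, mul_pow, pow_add e]
    have : e ^ k * e' ^ k = 1 := by rw [← mul_pow, hee, one_pow]
    push_cast
    rw [neg_pow ((x : ℂ) / 2), pow_add (-1 : ℂ)]
    linear_combination ((x / 2 : ℂ) ^ (n + k) / (n + k).factorial * e ^ n *
      ((-1) ^ n * (-1) ^ k * (x / 2 : ℂ) ^ k / k.factorial)) * this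
  rw [← diffEquiv.hasSum_iff] at hprod
  have hpos : Summable fun p : ℕ × ℕ => (besselTerm x p.1 p.2 : ℂ) * e' ^ p.1 := by
    refine (hprod.summable.comp_injective Sum.inl_injective).congr fun p => ?_
    exact hterm p.1 p.2
  have hneg : Summable fun p : ℕ × ℕ =>
      (besselTerm x (p.1 + 1) p.2 : ℂ) * ((-1) ^ (p.1 + 1) * e ^ (p.1 + 1)) := by
    refine (hprod.summable.comp_injective Sum.inr_injective).congr fun p => ?_
    exact hterm' (p.1 + 1) p.2
  obtain ⟨A, hA⟩ := hpos
  obtain ⟨B, hB⟩ := hneg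
  have hsplit := HasSum.sum
    (f := (fun p : ℕ × ℕ => u ^ p.1 / p.1.factorial * (v ^ p.2 / p.2.factorial)) ∘ diffEquiv)
    (hA.congr_fun fun p => hterm p.1 p.2)
    (hB.congr_fun fun p => hterm' (p.1 + 1) p.2)
  rw [hprod.unique hsplit]
  have h1 := hasSum_besselJ_mul (m := 0) (c := fun n => e' ^ n) hA
  have h2 := hasSum_besselJ_mul (m := 1) (c := fun n => (-1) ^ n * e ^ n) hB
  simp only [add_zero] at h1
  have h3 : HasSum (fun n => if n = 0 then 0 else (besselJ n x : ℂ) * ((-1) ^ n * e ^ n)) B := by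
    rw [← hasSum_nat_add_iff' 1]
    simpa using h2
  refine (h1.add h3).congr_fun fun n => ?_
  unfold angerTerm
  split_ifs with hn
  · simp [hn]
  · rw [he, he', ← Complex.exp_nat_mul, ← Complex.exp_nat_mul, mul_add]
    congr 4 <;> ring

/-! ### The Bessel–Neumann series -/

lemma coeffB_eq_integral {Z : ℝ → ℝ → ℝ} (hZ : Continuous (Function.uncurry Z)) (n : ℕ) (θ : ℝ) :
    coeffB Z n θ = ∫ γ in (0 : ℝ)..(2 * Real.pi), (Z γ θ : ℂ) * angerTerm n γ := by
  have hc : Continuous fun γ => (Z γ θ : ℂ) :=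
    Complex.continuous_ofReal.comp (hZ.comp (Continuous.prodMk_left θ))
  have hpi : 2 * (Real.pi : ℂ) ≠ 0 := by simp [Real.pi_ne_zero]
  unfold coeffB
  split_ifs with hn
  · rw [coeffC, ← mul_assoc, mul_one_div_cancel hpi, one_mul]
    simp [angerTerm, hn]
  · have hconj : (starRingEnd ℂ) (coeffC Z n θ) = 1 / (2 * (Real.pi : ℂ)) *
        ∫ γ in (0 : ℝ)..(2 * Real.pi), (Z γ θ : ℂ) * Complex.exp (Complex.I * n * γ) := by
      rw [coeffC, map_mul, ← intervalIntegral.intervalIntegral_conj]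
      congr 1
      · simp [map_ofNat (starRingEnd ℂ) 2]
      · refine intervalIntegral.integral_congr fun γ _ => ?_
        simp [← Complex.exp_conj]
    rw [hconj, coeffC, mul_left_comm ((-1 : ℂ) ^ n), ← mul_add, ← mul_assoc, mul_one_div_cancel hpi,
      one_mul, ← intervalIntegral.integral_const_mul, ← intervalIntegral.integral_add]
    · refine intervalIntegral.integral_congr fun γ _ => ?_
      simp only [angerTerm, if_neg hn]
      ring
    · exact Continuous.intervalIntegrable (by fun_prop) _ _
    · exact Continuous.intervalIntegrable (by fun_prop) _ _

/-- Termwise integration of the Jacobi–Anger expansion against `Z`. -/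
lemma hasSum_coeffB_mul_besselJ {Z : ℝ → ℝ → ℝ} (hZ : Continuous (Function.uncurry Z)) (x θ : ℝ) :
    HasSum (fun n => coeffB Z n θ * (besselJ n x : ℂ))
      (∫ γ in (0 : ℝ)..(2 * Real.pi),
        (Z γ θ : ℂ) * Complex.exp (-(Complex.I * (x * Real.sin γ : ℝ)))) := by
  have hc : Continuous fun γ => (Z γ θ : ℂ) :=
    Complex.continuous_ofReal.comp (hZ.comp (Continuous.prodMk_left θ))
  have h := intervalIntegral.hasSum_integral_of_dominated_convergence
    (μ := volume) (a := 0) (b := 2 * Real.pi)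
    (F := fun (n : ℕ) γ => (Z γ θ : ℂ) * ((besselJ n x : ℂ) * angerTerm n γ))
    (f := fun γ => (Z γ θ : ℂ) * Complex.exp (-(Complex.I * (x * Real.sin γ : ℝ))))
    (fun n γ => ‖(Z γ θ : ℂ)‖ * (‖besselJ n x‖ * 2))
    (fun n => Continuous.aestronglyMeasurable (by fun_prop))
    (fun n => Eventually.of_forall fun γ _ => by
      rw [norm_mul, norm_mul, Complex.norm_real (besselJ n x)]
      gcongr
      exact norm_angerTerm_le n γ)
    (Eventually.of_forall fun γ _ => ((summable_norm_besselJ x).mul_right 2).mul_left _)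
    (by
      simp only [tsum_mul_left]
      exact Continuous.intervalIntegrable (by fun_prop) _ _)
    (Eventually.of_forall fun γ _ => (hasSum_jacobiAnger x γ).mul_left _)
  refine h.congr_fun fun n => ?_
  rw [coeffB_eq_integral hZ, ← intervalIntegral.integral_mul_const]
  refine intervalIntegral.integral_congr fun γ _ => ?_
  ring

end FanBeam
end

theorem mainTheorem2 (D : ℝ) (hD : 0 < D) (g : ℝ → ℝ → ℝ) (hg : FanBeam.IsLinearSinogram g)
    (w z Z : ℝ → ℝ → ℝ) (hw : w = FanBeam.rebin D g)
    (hz : z = fun γ β => FanBeam.tau D γ * w γ β) (hZ : Z = FanBeam.shear z) :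
    -- the integrals that define the backprojection and the coefficients make sense
    (∀ x : FanBeam.Plane,
      IntervalIntegrable (FanBeam.backprojectionIntegrand D g x) MeasureTheory.volume
        0 (2 * Real.pi)) ∧
    Continuous (Function.uncurry Z) ∧
    -- the Bessel-Neumann series converges
    (∀ σ θ : ℝ, 0 < σ →
      Summable fun n : ℕ => FanBeam.coeffB Z n θ * (FanBeam.besselJ n (D * σ) : ℂ)) ∧
    -- the Fourier transform of the backprojection, in polar coordinates, is that series over `σ`
    ∃ F : FanBeam.Plane → ℂ,
      FanBeam.IsDistributionalFourier (fun x => (FanBeam.linearBackprojection D g x : ℂ)) F ∧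
      ContinuousOn F {0}ᶜ ∧
      ∀ σ θ : ℝ, 0 < σ →
        F (σ • FanBeam.xi θ) =
          1 / (σ : ℂ) * ∑' n : ℕ, FanBeam.coeffB Z n θ * (FanBeam.besselJ n (D * σ) : ℂ) := by
  have hzk : ∀ γ θ, Z γ θ = FanBeam.fanKernel D g (Real.cos γ) (Real.sin γ) (θ - γ) := fun γ θ => by
    rw [hZ, FanBeam.shear, hz, hw]
    exact FanBeam.tau_mul_rebin D g γ (θ - γ)
  have hZc : Continuous (Function.uncurry Z) := by
    have e : Function.uncurry Z = fun p : ℝ × ℝ =>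
        FanBeam.fanKernel D g (Real.cos p.1) (Real.sin p.1) (p.2 - p.1) := funext fun p => hzk p.1 p.2
    rw [e]
    refine Continuous.fanKernel hD hg (by fun_prop) (by fun_prop) (by fun_prop) fun p => ?_
    rw [Real.cos_sq_add_sin_sq]
    exact one_ne_zero
  refine ⟨fun x => FanBeam.intervalIntegrable_backprojectionIntegrand hD hg x _ _, hZc,
    fun σ θ _ => (FanBeam.hasSum_coeffB_mul_besselJ hZc (D * σ) θ).summable,
    FanBeam.backprojectionFourier D g, FanBeam.isDistributionalFourier_backprojection hD hg,
    FanBeam.continuousOn_backprojectionFourier hD hg, fun σ θ hσ => ?_⟩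
  rw [(FanBeam.hasSum_coeffB_mul_besselJ hZc (D * σ) θ).tsum_eq,
    FanBeam.backprojectionFourier_polar hg hσ]
  simp only [hzk]
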